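/- Let $F$ be a real Fréchet space whose topology is defined by a sequence of seminorms $(\|\cdot\|_n)_{n\in\mathbb N}$, and let $M$ be a Hausdorff manifold of class $C^k$ modelled on $F$, $4\le k\le\infty$, where $C^k$ is understood in the Michal–Bastiani sense. Let $\tau\colon TM\to M$ and $\tau_2\colon T(TM)\to TM$ be the projections. A chart $\varphi\colon U\to F$ of $M$ induces the chart $\varphi_*=T\varphi\colon v\mapsto(\varphi(\tau(v)),v_\varphi)$ of $TM$, where $v_\varphi=d\varphi(v)$; for $w\in T_v(TM)$ write $d(\varphi_*)_v(w)=(w_{\varphi_*,1},w_{\varphi_*,2})\in F\times F$. A spray on $M$ of class $C^r$ ($1\le r\le k-2$) is a $C^r$ map $\mathsf V\colon TM\to T(TM)$ with $\tau_2\circ \mathsf V=\mathrm{id}_{TM}$, $\tau_*\circ \mathsf V=\mathrm{id}_{TM}$, and $\mathsf V(sv)=(L_s)_*\bigl(s\,\mathsf V(v)\bigr)$ for all $s\in\mathbb R$, $v\in TM$, where $L_s\colon TM\to TM$, $v\mapsto sv$. A geodesic of $\mathsf V$ on an interval $I\subseteq\mathbb R$ is a curve $g\colon I\to M$ whose canonical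 lift $g'\colon I\to TM$ is an integral curve of $\mathsf V$, i.e. $g''=\mathsf V(g')$ on $I$. For $A\subseteq F$, $A\ne\emptyset$, put $d_n(x,A)=\inf_{y\in A}\|x-y\|_n$. Let $S\subseteq M$ and $s\in S$. The adjacent cone of $S$ at $s$ is the set of all $v\in T_sM$ such that for some chart $(U,\varphi)$ around $s$ $$\lim_{t\to0^+}t^{-1}d_n\bigl(\varphi(s)+t\,v_\varphi,\ \varphi(U\cap S)\bigr)=0\quad\text{for all }n .$$ The second-order adjacent cone $T^2_sS$ is the set of all $w\in T_v(TM)$, with $v$ in the adjacent cone of $S$ at $s$, such that for some chart $(U,\varphi)$ around $s$ one has $w_{\varphi_*,1}=v_\varphi$ and $$\lim_{t\to0^+}t^{-2}d_n\bigl(\varphi(s)+t\,v_\varphi+\tfrac12t^2\,w_{\varphi_*,2},\ \varphi(U\cap S)\bigr)=0\quad\text{for all }n .$$ The admissible set is $A_{\mathsf V,S}=\{v\in TM:\ \tau(v)\in S,\ \mathsf V(v)\in T^2_{\tau(v)}S\}$. **Theorem.** Let $\mathsf V$ be a spray on $M$, let $S\subseteq M$ be nonempty and closed, let $I\subseteq\mathbb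 R$ be an interval without a greatest element (for instance an open interval), and let $g\colon I\to M$ be a geodesic of $\mathsf V$ (derivatives at a left end point belonging to $I$ are one-sided). Then $$g(t)\in S\ \text{ for all } t\in I\quad\Longleftrightarrow\quad g'(t)\in A_{\mathsf V,S}\ \text{ for all } t\in I .$$ -/

import Mathlib

namespace FrechetGeometry

noncomputable section

open Set Filter Topology

universe u v w

set_option linter.unusedSectionVars false

/-! ### Michal–Bastiani calculus in topological vector spaces -/

section Calculus

variable {E : Type u} [AddCommGroup E] [Module ℝ E] [TopologicalSpace E]
variable {F : Type v} [AddCommGroup F] [Module ℝ F] [TopologicalSpace F]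

/-- `y` is the derivative of `f` at `x` in the direction `h`:
`y = lim_{t → 0} t⁻¹ (f (x + t h) - f x)`. -/
def HasDirDeriv (f : E → F) (x h : E) (y : F) : Prop :=
  Tendsto (fun t : ℝ => t⁻¹ • (f (x + t • h) - f x)) (𝓝[≠] 0) (𝓝 y)

/-- The derivative of `f` at `x` in the direction `h` (a junk value if it does not exist). -/
def dirDeriv (f : E → F) (x h : E) : F :=
  limUnder (𝓝[≠] (0 : ℝ)) (fun t : ℝ => t⁻¹ • (f (x + t • h) - f x))

/-- The iterated directional derivatives `d^j f (x) (h₁, …, h_j)`. -/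
def iterDirDeriv (f : E → F) : (j : ℕ) → E → (Fin j → E) → F
  | 0, x, _ => f x
  | j + 1, x, h => dirDeriv (fun y => iterDirDeriv f j y (Fin.init h)) x (h (Fin.last j))

/-- `f` is of class `C^k` on the open set `U` in the sense of Michal–Bastiani: the iterated
directional derivatives up to order `k` exist on `U`, and `d^j f : U × E^j → F` is continuous for
every `j ≤ k` (for `j = 0` this is the continuity of `f`). -/
structure BastianiOn (k : ℕ∞) (f : E → F) (U : Set E) : Prop where
  exists_deriv : ∀ j : ℕ, ((j + 1 : ℕ) : ℕ∞) ≤ k → ∀ x ∈ U, ∀ h : Fin (j + 1) → E,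
    ∃ y, HasDirDeriv (fun z => iterDirDeriv f j z (Fin.init h)) x (h (Fin.last j)) y
  continuousOn : ∀ j : ℕ, (j : ℕ∞) ≤ k →
    ContinuousOn (fun q : E × (Fin j → E) => iterDirDeriv f j q.1 q.2) (U ×ˢ univ)

/-- `y` is the derivative at `t` of the curve `c`, restricted to the set `I` of times. -/
def HasCurveDerivWithinAt (c : ℝ → F) (I : Set ℝ) (t : ℝ) (y : F) : Prop :=
  Tendsto (fun s : ℝ => (s - t)⁻¹ • (c s - c t)) (𝓝[I \ {t}] t) (𝓝 y)

theorem iterDirDeriv_one (f : E → F) (x : E) (h : Fin 1 → E) :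
    iterDirDeriv f 1 x h = dirDeriv f x (h 0) := rfl

theorem HasDirDeriv.dirDeriv_eq [T2Space F] {f : E → F} {x h : E} {y : F}
    (hf : HasDirDeriv f x h y) : dirDeriv f x h = y :=
  Tendsto.limUnder_eq hf

theorem HasDirDeriv.congr [IsTopologicalAddGroup E] [ContinuousSMul ℝ E] {f g : E → F} {x h : E}
    {y : F} (hf : HasDirDeriv f x h y) (hfg : f =ᶠ[𝓝 x] g) : HasDirDeriv g x h y := by
  refine Tendsto.congr' ?_ hf
  have hc : Tendsto (fun t : ℝ => x + t • h) (𝓝[≠] 0) (𝓝 x) := by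
    have : Continuous (fun t : ℝ => x + t • h) := by fun_prop
    simpa using (this.tendsto 0).mono_left nhdsWithin_le_nhds
  filter_upwards [hc.eventually hfg] with t ht
  rw [ht, hfg.self_of_nhds]

theorem BastianiOn.hasDirDeriv [T2Space F] {f : E → F} {U : Set E} {k : ℕ∞}
    (hf : BastianiOn k f U) (hk : 1 ≤ k) {x : E} (hx : x ∈ U) (h : E) :
    HasDirDeriv f x h (dirDeriv f x h) := by
  obtain ⟨y, hy⟩ := hf.exists_deriv 0 (by simpa using hk) x hx (fun _ => h)
  have hy' : HasDirDeriv f x h y := hy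
  rwa [hy'.dirDeriv_eq]

theorem BastianiOn.continuousOn_self {f : E → F} {U : Set E} {k : ℕ∞}
    (hf : BastianiOn k f U) : ContinuousOn f U := by
  have h0 := hf.continuousOn 0 (by simp)
  have : ContinuousOn (fun x : E => (x, (fun i : Fin 0 => i.elim0 : Fin 0 → E))) U := by fun_prop
  exact h0.comp this (fun x hx => ⟨hx, mem_univ _⟩)

theorem BastianiOn.continuousOn_dirDeriv {f : E → F} {U : Set E} {k : ℕ∞}
    (hf : BastianiOn k f U) (hk : 1 ≤ k) :
    ContinuousOn (fun q : E × E => dirDeriv f q.1 q.2) (U ×ˢ univ) := by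
  have h0 := hf.continuousOn 1 (by exact_mod_cast hk)
  simp only [iterDirDeriv_one] at h0
  have h1 : Continuous (fun q : E × E => (q.1, (fun _ => q.2 : Fin 1 → E))) := by fun_prop
  have h2 : MapsTo (fun q : E × E => (q.1, (fun _ => q.2 : Fin 1 → E))) (U ×ˢ univ)
      (U ×ˢ univ) := fun q hq => ⟨hq.1, mem_univ _⟩
  have h3 := h0.comp h1.continuousOn h2
  simp only [Function.comp_def] at h3
  exact h3

theorem bastianiOn_one {f : E → F} {U : Set E} (hc : ContinuousOn f U)
    (hd : ∀ x ∈ U, ∀ h, ∃ y, HasDirDeriv f x h y)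
    (hdc : ContinuousOn (fun q : E × E => dirDeriv f q.1 q.2) (U ×ˢ univ)) :
    BastianiOn 1 f U where
  exists_deriv j hj x hx h := by
    have : j = 0 := by
      have : j + 1 ≤ 1 := by exact_mod_cast hj
      omega
    subst this
    exact hd x hx _
  continuousOn j hj := by
    have hj1 : j ≤ 1 := by exact_mod_cast hj
    rcases Nat.le_one_iff_eq_zero_or_eq_one.1 hj1 with rfl | rfl
    · exact hc.comp continuous_fst.continuousOn (fun q hq => hq.1)
    · have h1 : Continuous (fun q : E × (Fin 1 → E) => (q.1, q.2 0)) := by fun_prop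
      have h2 : MapsTo (fun q : E × (Fin 1 → E) => (q.1, q.2 0)) (U ×ˢ univ)
        (U ×ˢ univ) := fun q hq => ⟨hq.1, mem_univ _⟩
      have h3 := hdc.comp h1.continuousOn h2
      simp only [Function.comp_def] at h3
      simp only [iterDirDeriv_one]
      exact h3

end Calculus

section ChainRule

variable {E : Type u} [AddCommGroup E] [Module ℝ E] [TopologicalSpace E]
  [IsTopologicalAddGroup E] [ContinuousSMul ℝ E] [LocallyConvexSpace ℝ E]
variable {F : Type v} [AddCommGroup F] [Module ℝ F] [TopologicalSpace F]
  [IsTopologicalAddGroup F] [ContinuousSMul ℝ F] [LocallyConvexSpace ℝ F] [T2Space F]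

/-- Mean value inclusion: if the derivatives of a curve lie in a closed convex set, so do its
difference quotients. -/
theorem slope_mem_of_closed_convex {c : ℝ → F} {D : ℝ → F} {C : Set F} (hC : IsClosed C)
    (hCc : Convex ℝ C) {t : ℝ} (ht : t ≠ 0)
    (hd : ∀ s ∈ uIcc 0 t, HasDirDeriv c s 1 (D s) ∧ D s ∈ C) :
    t⁻¹ • (c t - c 0) ∈ C := by
  by_contra hnot
  obtain ⟨l, r, hl, hr⟩ := geometric_hahn_banach_closed_point hCc hC hnot
  have hder : ∀ s ∈ uIcc 0 t, HasDerivAt (fun s => l (c s)) (l (D s)) s := by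
    intro s hs
    rw [hasDerivAt_iff_tendsto_slope_zero]
    have := (l.continuous.tendsto _).comp (hd s hs).1
    refine this.congr fun x => ?_
    simp
  have key : ∃ s ∈ uIcc 0 t, l (D s) = t⁻¹ * (l (c t) - l (c 0)) := by
    rcases lt_or_gt_of_ne ht with h | h
    · rw [uIcc_of_ge h.le] at hder ⊢
      obtain ⟨s, hs, hs'⟩ := exists_hasDerivAt_eq_slope (fun s => l (c s)) (fun s => l (D s)) h
        (fun s hs => (hder s hs).continuousAt.continuousWithinAt)
        (fun s hs => hder s (Ioo_subset_Icc_self hs))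
      refine ⟨s, Ioo_subset_Icc_self hs, ?_⟩
      rw [hs']
      field_simp
      ring
    · rw [uIcc_of_le h.le] at hder ⊢
      obtain ⟨s, hs, hs'⟩ := exists_hasDerivAt_eq_slope (fun s => l (c s)) (fun s => l (D s)) h
        (fun s hs => (hder s hs).continuousAt.continuousWithinAt)
        (fun s hs => hder s (Ioo_subset_Icc_self hs))
      refine ⟨s, Ioo_subset_Icc_self hs, ?_⟩
      rw [hs']
      field_simp
      ring
  obtain ⟨s, hs, hs'⟩ := key
  have h1 := hl _ (hd s hs).2
  simp only [map_smul, map_sub, smul_eq_mul] at hr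
  linarith

/-- Chain rule: a `C^1` map composed with a curve that is differentiable at `0`. -/
theorem BastianiOn.comp_curve {f : E → F} {U : Set E} (hf : BastianiOn 1 f U) (hU : IsOpen U)
    {c : ℝ → E} (hc0 : c 0 ∈ U) {w : E} (hc : HasDirDeriv c 0 1 w) :
    HasDirDeriv (f ∘ c) 0 1 (dirDeriv f (c 0) w) := by
  have hslope : Tendsto (fun t : ℝ => t⁻¹ • (c t - c 0)) (𝓝[≠] 0) (𝓝 w) := by
    refine Tendsto.congr (fun t => ?_) hc
    simp
  have hcont : Tendsto c (𝓝[≠] 0) (𝓝 (c 0)) := by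
    have h1 : Tendsto (fun t : ℝ => c 0 + t • (t⁻¹ • (c t - c 0))) (𝓝[≠] 0)
        (𝓝 (c 0 + (0 : ℝ) • w)) :=
      tendsto_const_nhds.add ((tendsto_nhdsWithin_of_tendsto_nhds tendsto_id).smul hslope)
    rw [zero_smul, add_zero] at h1
    refine Tendsto.congr' ?_ h1
    filter_upwards [self_mem_nhdsWithin] with t ht
    rw [smul_smul, mul_inv_cancel₀ ht, one_smul, add_sub_cancel]
  have goal : Tendsto (fun t : ℝ => t⁻¹ • (f (c t) - f (c 0))) (𝓝[≠] 0)
      (𝓝 (dirDeriv f (c 0) w)) := by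
    intro W hW
    obtain ⟨N0, ⟨hN0, hN0c⟩, hN0W⟩ := (closed_nhds_basis (dirDeriv f (c 0) w)).mem_iff.1 hW
    obtain ⟨N1, ⟨hN1, hN1c⟩, hN1N⟩ :=
      (LocallyConvexSpace.convex_basis (𝕜 := ℝ) (dirDeriv f (c 0) w)).mem_iff.1 hN0
    set C := closure N1 with hCdef
    have hCW : C ⊆ W := (closure_minimal hN1N hN0c).trans hN0W
    have hCn : C ∈ 𝓝 (dirDeriv f (c 0) w) := mem_of_superset hN1 subset_closure
    have hopen : IsOpen (U ×ˢ (univ : Set E)) := hU.prod isOpen_univ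
    have hca : ContinuousAt (fun q : E × E => dirDeriv f q.1 q.2) (c 0, w) :=
      (hf.continuousOn_dirDeriv le_rfl).continuousAt (hopen.mem_nhds ⟨hc0, mem_univ _⟩)
    have hev : ∀ᶠ q : E × E in 𝓝 (c 0) ×ˢ 𝓝 w, q.1 ∈ U ∧ dirDeriv f q.1 q.2 ∈ C := by
      rw [← nhds_prod_eq]
      refine Filter.Eventually.and ?_ (hca hCn)
      exact continuousAt_fst (hU.mem_nhds hc0)
    obtain ⟨P, hP, Q, hQ, hPQ⟩ := Filter.eventually_prod_iff.1 hev
    obtain ⟨V, ⟨hV, hVc⟩, hVP⟩ :=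
      (LocallyConvexSpace.convex_basis (𝕜 := ℝ) (c 0)).mem_iff.1 hP
    show ∀ᶠ t in 𝓝[≠] (0 : ℝ), t⁻¹ • (f (c t) - f (c 0)) ∈ W
    filter_upwards [self_mem_nhdsWithin, hcont hV, hslope hQ] with t ht htV htQ
    have ht' : t ≠ 0 := ht
    set z := t⁻¹ • (c t - c 0) with hz
    have hz' : t • z = c t - c 0 := by rw [hz, smul_smul, mul_inv_cancel₀ ht', one_smul]
    apply hCW
    have hend : c 0 + t • z = c t := by rw [hz', add_sub_cancel]
    have := slope_mem_of_closed_convex (c := fun s => f (c 0 + s • z))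
      (D := fun s => dirDeriv f (c 0 + s • z) z) (C := C) isClosed_closure hN1c.closure ht'
      (fun s hs => by
        have hmem : c 0 + s • z ∈ V := by
          have hs1 : 0 ≤ s / t ∧ s / t ≤ 1 := by
            rcases lt_or_gt_of_ne ht' with h | h
            · rw [uIcc_of_ge h.le] at hs
              exact ⟨div_nonneg_of_nonpos hs.2 h.le, (div_le_one_of_neg h).2 hs.1⟩
            · rw [uIcc_of_le h.le] at hs
              exact ⟨div_nonneg hs.1 h.le, (div_le_one h).2 hs.2⟩
          have := hVc.add_smul_sub_mem (mem_of_mem_nhds hV) htV hs1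
          rwa [← hz', smul_smul, div_mul_cancel₀ s ht'] at this
        have h2 := hPQ (hVP hmem) htQ
        refine ⟨?_, h2.2⟩
        refine Tendsto.congr (fun x => ?_) (hf.hasDirDeriv le_rfl h2.1 z)
        simp only [smul_eq_mul, mul_one]
        rw [add_smul, add_assoc])
    simpa [hend] using this
  refine Tendsto.congr (fun t => ?_) goal
  simp

/-- A `C^1` map composed with an affine line. -/
theorem BastianiOn.comp_line {f : E → F} {U : Set E} (hf : BastianiOn 1 f U) (x h : E) :
    BastianiOn 1 (fun s : ℝ => f (x + s • h)) ((fun s : ℝ => x + s • h) ⁻¹' U) := by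
  have hA : Continuous (fun s : ℝ => x + s • h) := by fun_prop
  have hd : ∀ s ∈ (fun s : ℝ => x + s • h) ⁻¹' U, ∀ r : ℝ,
      HasDirDeriv (fun s : ℝ => f (x + s • h)) s r (dirDeriv f (x + s • h) (r • h)) := by
    intro s hs r
    refine Tendsto.congr (fun t => ?_) (hf.hasDirDeriv le_rfl hs (r • h))
    simp only [smul_eq_mul]
    rw [add_smul, smul_smul, add_assoc]
  refine bastianiOn_one (hf.continuousOn_self.comp hA.continuousOn fun s hs => hs)
    (fun s hs r => ⟨_, hd s hs r⟩) ?_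
  have hB : Continuous (fun q : ℝ × ℝ => (x + q.1 • h, q.2 • h)) := by fun_prop
  refine ((hf.continuousOn_dirDeriv le_rfl).comp hB.continuousOn
    (s := ((fun s : ℝ => x + s • h) ⁻¹' U) ×ˢ univ) fun q hq => ⟨hq.1, mem_univ _⟩).congr ?_
  intro q hq
  exact (hd q.1 hq.1 q.2).dirDeriv_eq

theorem BastianiOn.of_le {f : E → F} {U : Set E} {k l : ℕ∞} (hf : BastianiOn k f U)
    (h : l ≤ k) : BastianiOn l f U where
  exists_deriv j hj := hf.exists_deriv j (hj.trans h)
  continuousOn j hj := hf.continuousOn j (hj.trans h)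

theorem bastianiOn_const (y : F) (U : Set E) : BastianiOn 1 (fun _ : E => y) U := by
  have hd : ∀ x h : E, HasDirDeriv (fun _ : E => y) x h (0 : F) := fun x h => by
    simp only [HasDirDeriv, sub_self, smul_zero]
    exact tendsto_const_nhds
  refine bastianiOn_one continuousOn_const (fun x _ h => ⟨_, hd x h⟩) ?_
  simp only [(hd _ _).dirDeriv_eq]
  exact continuousOn_const

end ChainRule

/-! ### Manifolds modelled on locally convex spaces and their tangent bundles -/

section Manifold

/-- `X`, with its given atlas of charts with values in `E`, is a manifold of class `C^k`, `1 ≤ k`,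
in the sense of Michal–Bastiani: all changes of charts are of class `C^k`. -/
class BastianiManifold (k : outParam ℕ∞) (E : Type u) [AddCommGroup E] [Module ℝ E]
    [TopologicalSpace E] (X : Type v) [TopologicalSpace X] [ChartedSpace E X] : Prop where
  one_le : 1 ≤ k
  transition : ∀ e ∈ atlas E X, ∀ e' ∈ atlas E X,
    BastianiOn k (e' ∘ e.symm) (e.symm.trans e').source

variable (E : Type u) [AddCommGroup E] [Module ℝ E] [TopologicalSpace E]
variable {X : Type v} [TopologicalSpace X] [ChartedSpace E X]

/-- `γ` is a tangent curve (at the point `γ 0`): it is of class `C^1` on some open set of times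
containing `0`. -/
def IsTangentCurve (γ : ℝ → X) : Prop :=
  ∃ J : Set ℝ, IsOpen J ∧ (0 : ℝ) ∈ J ∧ ContinuousOn γ J ∧
    ∀ e ∈ atlas E X, BastianiOn 1 (e ∘ γ) (J ∩ γ ⁻¹' e.source)

variable (X)

/-- Two tangent curves are equivalent if they pass at time `0` through the same point, with the
same velocity in the charts around this point. -/
def tangentSetoid : Setoid {γ : ℝ → X // IsTangentCurve E γ} where
  r γ δ := γ.1 0 = δ.1 0 ∧ ∀ e ∈ atlas E X, γ.1 0 ∈ e.source →
    dirDeriv (e ∘ γ.1) 0 1 = dirDeriv (e ∘ δ.1) 0 1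
  iseqv :=
    { refl := fun _ => ⟨rfl, fun _ _ _ => rfl⟩
      symm := fun h => ⟨h.1.symm, fun e he hx => (h.2 e he (h.1 ▸ hx)).symm⟩
      trans := fun h h' => ⟨h.1.trans h'.1,
        fun e he hx => (h.2 e he hx).trans (h'.2 e he (h.1 ▸ hx))⟩ }

/-- The tangent bundle of `X`, as the set of equivalence classes of tangent curves. -/
def TangentBdl : Type v := Quotient (tangentSetoid E X)

variable {X}

namespace TangentBdl

variable {E}

/-- The class of a tangent curve. -/
def mk (γ : ℝ → X) (h : IsTangentCurve E γ) : TangentBdl E X :=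
  Quotient.mk (tangentSetoid E X) ⟨γ, h⟩

/-- A tangent curve which represents the tangent vector `v`. -/
def rep (v : TangentBdl E X) : ℝ → X := (Quotient.out v).1

/-- The foot point of a tangent vector: the projection `τ : T X → X`. -/
def base (v : TangentBdl E X) : X := v.rep 0

/-- The principal part `v_e = d e (v)` of the tangent vector `v` in a chart `e` of the atlas around
its foot point. -/
def coord (e : OpenPartialHomeomorph X E) (v : TangentBdl E X) : E := dirDeriv (e ∘ v.rep) 0 1

theorem isTangentCurve_rep (v : TangentBdl E X) : IsTangentCurve E v.rep := (Quotient.out v).2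

theorem rep_mk (γ : ℝ → X) (h : IsTangentCurve E γ) : (mk γ h).rep 0 = γ 0 ∧
    ∀ e ∈ atlas E X, (mk γ h).rep 0 ∈ e.source →
      dirDeriv (e ∘ (mk γ h).rep) 0 1 = dirDeriv (e ∘ γ) 0 1 :=
  Quotient.mk_out (s := tangentSetoid E X) ⟨γ, h⟩

theorem ext {v w : TangentBdl E X} (h : v.base = w.base)
    (hc : ∀ e ∈ atlas E X, v.base ∈ e.source → coord e v = coord e w) : v = w :=
  Quotient.out_equiv_out.1 ⟨h, hc⟩

end TangentBdl

end Manifold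

section Bundle

variable {E : Type u} [AddCommGroup E] [Module ℝ E] [TopologicalSpace E]
  [IsTopologicalAddGroup E] [ContinuousSMul ℝ E] [LocallyConvexSpace ℝ E] [T2Space E]
variable {X : Type v} [TopologicalSpace X] [ChartedSpace E X]

theorem isTangentCurve_const (x : X) : IsTangentCurve E (fun _ : ℝ => x) :=
  ⟨univ, isOpen_univ, mem_univ _, continuousOn_const, fun e _ => bastianiOn_const (e x) _⟩

variable (E) in
open Classical in
/-- The class `[γ]` of a tangent curve `γ` (the zero vector at `γ 0` if `γ` is not a tangent
curve). -/
def velocity (γ : ℝ → X) : TangentBdl E X :=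
  if h : IsTangentCurve E γ then TangentBdl.mk γ h
  else TangentBdl.mk (fun _ => γ 0) (isTangentCurve_const (γ 0))

theorem velocity_base (γ : ℝ → X) : (velocity E γ).base = γ 0 := by
  unfold velocity
  split_ifs with h
  · exact (TangentBdl.rep_mk γ h).1
  · exact (TangentBdl.rep_mk (fun _ => γ 0) (isTangentCurve_const (γ 0))).1

theorem velocity_coord {γ : ℝ → X} (h : IsTangentCurve E γ) {e : OpenPartialHomeomorph X E}
    (he : e ∈ atlas E X) (hx : γ 0 ∈ e.source) :
    TangentBdl.coord e (velocity E γ) = dirDeriv (e ∘ γ) 0 1 := by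
  have h1 := TangentBdl.rep_mk γ h
  unfold velocity
  rw [dif_pos h]
  exact h1.2 e he (by rw [h1.1]; exact hx)

theorem IsTangentCurve.hasDirDeriv {γ : ℝ → X} (h : IsTangentCurve E γ)
    {e : OpenPartialHomeomorph X E} (he : e ∈ atlas E X) (hx : γ 0 ∈ e.source) :
    HasDirDeriv (e ∘ γ) 0 1 (dirDeriv (e ∘ γ) 0 1) := by
  obtain ⟨J, _, h0, _, hJ⟩ := h
  exact (hJ e he).hasDirDeriv le_rfl ⟨h0, hx⟩ 1

theorem IsTangentCurve.continuousAt {γ : ℝ → X} (h : IsTangentCurve E γ) : ContinuousAt γ 0 := by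
  obtain ⟨J, hJo, h0, hc, _⟩ := h
  exact hc.continuousAt (hJo.mem_nhds h0)

theorem bastianiOn_transition {k : ℕ∞} [BastianiManifold k E X] {e e' : OpenPartialHomeomorph X E} (he : e ∈ atlas E X)
    (he' : e' ∈ atlas E X) : BastianiOn 1 (e' ∘ e.symm) (e.symm.trans e').source :=
  (BastianiManifold.transition e he e' he').of_le (BastianiManifold.one_le E X)

/-- Change of charts for the velocity of a curve. -/
theorem IsTangentCurve.dirDeriv_transition {k : ℕ∞} [BastianiManifold k E X] {γ : ℝ → X} (h : IsTangentCurve E γ)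
    {e e' : OpenPartialHomeomorph X E} (he : e ∈ atlas E X) (he' : e' ∈ atlas E X)
    (hx : γ 0 ∈ e.source) (hx' : γ 0 ∈ e'.source) :
    dirDeriv (e' ∘ γ) 0 1 = dirDeriv (e' ∘ e.symm) (e (γ 0)) (dirDeriv (e ∘ γ) 0 1) := by
  have hmem : (e ∘ γ) 0 ∈ (e.symm.trans e').source := by
    simp [e.left_inv hx, hx', e.map_source hx]
  have := (bastianiOn_transition he he').comp_curve (e.symm.trans e').open_source hmem
    (h.hasDirDeriv he hx)
  refine (this.congr ?_).dirDeriv_eq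
  filter_upwards [h.continuousAt (e.open_source.mem_nhds hx)] with s hs
  simp only [Function.comp_apply]
  rw [e.left_inv hs]

/-- The curve which is the straight line `s ↦ x + s h` in the chart `e`. -/
def lineCurve (e : OpenPartialHomeomorph X E) (q : E × E) : ℝ → X :=
  fun s => e.symm (q.1 + s • q.2)

theorem isTangentCurve_line {k : ℕ∞} [BastianiManifold k E X]
    {e : OpenPartialHomeomorph X E} (he : e ∈ atlas E X) {q : E × E}
    (hq : q.1 ∈ e.target) : IsTangentCurve E (lineCurve e q) := by
  have hA : Continuous (fun s : ℝ => q.1 + s • q.2) := by fun_prop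
  refine ⟨(fun s : ℝ => q.1 + s • q.2) ⁻¹' e.target, e.open_target.preimage hA, by simpa using hq,
    e.continuousOn_symm.comp hA.continuousOn fun s hs => hs, fun e' he' => ?_⟩
  have h := (bastianiOn_transition he he').comp_line q.1 q.2
  have hset : (fun s : ℝ => q.1 + s • q.2) ⁻¹' (e.symm.trans e').source =
      (fun s : ℝ => q.1 + s • q.2) ⁻¹' e.target ∩ lineCurve e q ⁻¹' e'.source := by
    ext s
    simp [lineCurve]
  rw [hset] at h
  exact h

theorem dirDeriv_lineCurve {e : OpenPartialHomeomorph X E} {q : E × E} (hq : q.1 ∈ e.target) :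
    dirDeriv (e ∘ lineCurve e q) 0 1 = q.2 := by
  have h1 : HasDirDeriv (fun s : ℝ => q.1 + s • q.2) 0 1 q.2 := by
    refine Tendsto.congr' ?_ (tendsto_const_nhds (x := q.2))
    filter_upwards [self_mem_nhdsWithin] with t ht
    have ht' : t ≠ 0 := ht
    simp [smul_smul, ht']
  have hA : Continuous (fun s : ℝ => q.1 + s • q.2) := by fun_prop
  refine (h1.congr ?_).dirDeriv_eq
  filter_upwards [(e.open_target.preimage hA).mem_nhds (by simpa using hq : (0 : ℝ) ∈ _)]
    with s hs
  exact (e.right_inv hs).symm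

/-- The chart `T e : v ↦ (e (τ v), d e (v))` of the tangent bundle induced by a chart `e` of the
atlas, defined over the domain of `e`. -/
def tangentChartEquiv {k : ℕ∞} [BastianiManifold k E X] (e : atlas E X) :
    PartialEquiv (TangentBdl E X) (E × E) where
  toFun v := (e.1 v.base, TangentBdl.coord e.1 v)
  invFun q := velocity E (lineCurve e.1 q)
  source := {v | v.base ∈ e.1.source}
  target := e.1.target ×ˢ univ
  map_source' v hv := ⟨e.1.map_source hv, mem_univ _⟩
  map_target' q hq := by
    show (velocity E (lineCurve e.1 q)).base ∈ e.1.source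
    rw [velocity_base]
    simpa [lineCurve] using e.1.map_target hq.1
  left_inv' v hv := by
    have hv' : v.base ∈ e.1.source := hv
    have hq : (e.1 v.base, TangentBdl.coord e.1 v).1 ∈ e.1.target := e.1.map_source hv'
    have hb : lineCurve e.1 (e.1 v.base, TangentBdl.coord e.1 v) 0 = v.base := by
      simp [lineCurve, e.1.left_inv hv']
    have hl := isTangentCurve_line e.2 hq
    refine TangentBdl.ext ((velocity_base _).trans hb) fun e' he' hx => ?_
    rw [velocity_base] at hx
    rw [velocity_coord hl he' hx,
      hl.dirDeriv_transition e.2 he' (by rw [hb]; exact hv') hx, dirDeriv_lineCurve hq, hb]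
    rw [hb] at hx
    exact (v.isTangentCurve_rep.dirDeriv_transition e.2 he' hv' hx).symm
  right_inv' q hq := by
    have hb : lineCurve e.1 q 0 ∈ e.1.source := by
      simpa [lineCurve] using e.1.map_target hq.1
    refine Prod.ext ?_ ?_
    · simp only [velocity_base]
      simpa [lineCurve] using e.1.right_inv hq.1
    · simp only
      rw [velocity_coord (isTangentCurve_line e.2 hq.1) e.2 hb, dirDeriv_lineCurve hq.1]

theorem tangentChartEquiv_trans_source {k : ℕ∞} [BastianiManifold k E X] (e e' : atlas E X) :
    ((tangentChartEquiv e).symm.trans (tangentChartEquiv e')).source =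
      (e.1.symm.trans e'.1).source ×ˢ univ := by
  ext q
  have h : (velocity E (lineCurve e.1 q)).base = e.1.symm q.1 := by
    rw [velocity_base]
    simp [lineCurve]
  have h' : q ∈ ((tangentChartEquiv e).symm.trans (tangentChartEquiv e')).source ↔
    (q.1 ∈ e.1.target ∧ q.2 ∈ univ) ∧ (velocity E (lineCurve e.1 q)).base ∈ e'.1.source := Iff.rfl
  rw [h', h]
  simp

/-- The changes of charts of the tangent bundle are `(x, h) ↦ (φ x, dφ x h)`. -/
theorem tangentChartEquiv_trans_apply {k : ℕ∞} [BastianiManifold k E X]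
    (e e' : atlas E X) {q : E × E}
    (hq : q.1 ∈ (e.1.symm.trans e'.1).source) :
    ((tangentChartEquiv e).symm.trans (tangentChartEquiv e')) q =
      ((e'.1 ∘ e.1.symm) q.1, dirDeriv (e'.1 ∘ e.1.symm) q.1 q.2) := by
  have hq' : q.1 ∈ e.1.target ∧ e.1.symm q.1 ∈ e'.1.source := by simpa using hq
  have h0 : lineCurve e.1 q 0 = e.1.symm q.1 := by simp [lineCurve]
  have hl := isTangentCurve_line e.2 hq'.1
  refine Prod.ext ?_ ?_
  · show e'.1 (velocity E (lineCurve e.1 q)).base = e'.1 (e.1.symm q.1)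
    rw [velocity_base, h0]
  · show TangentBdl.coord e'.1 (velocity E (lineCurve e.1 q)) = _
    rw [velocity_coord hl e'.2 (by rw [h0]; exact hq'.2),
      hl.dirDeriv_transition e.2 e'.2 (by rw [h0]; exact e.1.map_target hq'.1)
        (by rw [h0]; exact hq'.2), dirDeriv_lineCurve hq'.1, h0, e.1.right_inv hq'.1]

variable (E X) in
/-- The atlas of the tangent bundle, made of the charts `T e`. -/
def tangentCore {k : ℕ∞} [BastianiManifold k E X] :
    ChartedSpaceCore (E × E) (TangentBdl E X) where
  atlas := range (tangentChartEquiv (E := E) (X := X))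
  chartAt v := tangentChartEquiv ⟨chartAt E v.base, chart_mem_atlas E v.base⟩
  mem_chart_source v := mem_chart_source E v.base
  chart_mem_atlas v := ⟨_, rfl⟩
  open_source := by
    rintro _ _ ⟨e, rfl⟩ ⟨e', rfl⟩
    rw [tangentChartEquiv_trans_source]
    exact (e.1.symm.trans e'.1).open_source.prod isOpen_univ
  continuousOn_toFun := by
    rintro _ _ ⟨e, rfl⟩ ⟨e', rfl⟩
    rw [tangentChartEquiv_trans_source]
    have h := bastianiOn_transition e.2 e'.2
    refine ContinuousOn.congr (ContinuousOn.prodMk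
      (h.continuousOn_self.comp continuousOn_fst fun q hq => hq.1)
      (h.continuousOn_dirDeriv le_rfl)) fun q hq => ?_
    exact tangentChartEquiv_trans_apply e e' hq.1

instance {k : ℕ∞} [BastianiManifold k E X] : TopologicalSpace (TangentBdl E X) := (tangentCore E X).toTopologicalSpace

instance {k : ℕ∞} [BastianiManifold k E X] : ChartedSpace (E × E) (TangentBdl E X) :=
  (tangentCore E X).toChartedSpace

/-- The chart `T e` of the tangent bundle, as a homeomorphism between open sets. -/
def tangentChart {k : ℕ∞} [BastianiManifold k E X] (e : atlas E X) :
    OpenPartialHomeomorph (TangentBdl E X) (E × E) :=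
  (tangentCore E X).openPartialHomeomorph (tangentChartEquiv e) ⟨e, rfl⟩

/-- Multiplication by a scalar in the fibres of the tangent bundle: `r [γ] = [t ↦ γ (r t)]`. -/
instance : SMul ℝ (TangentBdl E X) := ⟨fun r v => velocity E fun t => v.rep (r * t)⟩

/-- The tangent map `f_* : T X → T Y`, `[γ] ↦ [f ∘ γ]`, of a `C^1` map `f` of manifolds modelled on
`E` and `E'`. -/
def tangentMap {E' : Type u} [AddCommGroup E'] [Module ℝ E'] [TopologicalSpace E']
    [IsTopologicalAddGroup E'] [ContinuousSMul ℝ E'] [LocallyConvexSpace ℝ E'] [T2Space E']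
    {Y : Type w} [TopologicalSpace Y] [ChartedSpace E' Y] (f : X → Y) (v : TangentBdl E X) :
    TangentBdl E' Y :=
  velocity E' (f ∘ v.rep)

/-- The tangent vector `v` is the derivative `γ'(t)` of the curve `γ : I → X` at the time `t ∈ I`
(a one-sided derivative if `t` is an end point of the interval `I`). -/
def HasVelocityWithinAt (γ : ℝ → X) (I : Set ℝ) (t : ℝ) (v : TangentBdl E X) : Prop :=
  v.base = γ t ∧ ContinuousWithinAt γ I t ∧
    ∀ e ∈ atlas E X, γ t ∈ e.source → HasCurveDerivWithinAt (e ∘ γ) I t (TangentBdl.coord e v)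

variable (E) in
open Classical in
/-- The canonical lift `γ' : I → T X` of a differentiable curve `γ : I → X` (the zero vector at
`γ t` where the derivative does not exist). -/
def canonicalLift (γ : ℝ → X) (I : Set ℝ) (t : ℝ) : TangentBdl E X :=
  if h : ∃ v : TangentBdl E X, HasVelocityWithinAt γ I t v then h.choose
  else velocity E fun _ => γ t

end Bundle

/-! ### Sprays, geodesics, and adjacent cones -/

section Spray

variable {F : Type u} [AddCommGroup F] [Module ℝ F] [TopologicalSpace F]
  [IsTopologicalAddGroup F] [ContinuousSMul ℝ F] [LocallyConvexSpace ℝ F] [T2Space F]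
variable {M : Type v} [TopologicalSpace M] [ChartedSpace F M]

variable (F M) in
/-- The double tangent bundle `T (T M)`. -/
abbrev DoubleTangentBdl {k : ℕ∞} [BastianiManifold k F M] : Type v :=
  TangentBdl (F × F) (TangentBdl F M)

/-- A spray of class `C^r` on `M`: a map `V : T M → T (T M)` with `τ₂ ∘ V = id` and
`τ_* ∘ V = id`, of class `C^r`, such that `V (s v) = (L_s)_* (s V (v))`, where `L_s` is the
multiplication by `s` in `T M`. By the condition `τ₂ ∘ V = id`, the class `C^r` of `V` is that of
the principal part of `V` in the charts `T e`. -/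
structure Spray (r : ℕ∞) (F : Type u) [AddCommGroup F] [Module ℝ F] [TopologicalSpace F]
    [IsTopologicalAddGroup F] [ContinuousSMul ℝ F] [LocallyConvexSpace ℝ F] [T2Space F]
    (M : Type v) [TopologicalSpace M] [ChartedSpace F M] {k : ℕ∞} [BastianiManifold k F M] where
  toFun : TangentBdl F M → DoubleTangentBdl F M
  base_toFun : ∀ v, (toFun v).base = v
  tangentMap_base_toFun : ∀ v, tangentMap (TangentBdl.base : TangentBdl F M → M) (toFun v) = v
  contDiff : ∀ e : atlas F M,
    BastianiOn r (fun q => TangentBdl.coord (tangentChart e) (toFun ((tangentChart e).symm q)))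
      (tangentChart e).target
  homogeneous : ∀ (s : ℝ) (v : TangentBdl F M),
    toFun (s • v) = tangentMap (fun z : TangentBdl F M => s • z) (s • toFun v)

/-- `g : I → M` is a geodesic of the spray `V`: its canonical lift `g'` is an integral curve of
`V`, that is, `g'' = V (g')` on `I`. -/
def IsGeodesicOn {k r : ℕ∞} [BastianiManifold k F M] (V : Spray r F M) (g : ℝ → M) (I : Set ℝ) :
    Prop :=
  ∀ t ∈ I, HasVelocityWithinAt g I t (canonicalLift F g I t) ∧
    HasVelocityWithinAt (canonicalLift F g I) I t (V.toFun (canonicalLift F g I t))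

/-- The pseudo-distance `d_q (x, A) = inf {q (x - y) | y ∈ A}` for a seminorm `q`. -/
def pseudoDist (q : Seminorm ℝ F) (x : F) (A : Set F) : ℝ := sInf ((fun y => q (x - y)) '' A)

/-- The adjacent cone of `S ⊆ M` at `s ∈ S`. -/
def adjacentCone (p : ℕ → Seminorm ℝ F) (S : Set M) (s : M) : Set (TangentBdl F M) :=
  {v | v.base = s ∧ ∃ e ∈ atlas F M, s ∈ e.source ∧ ∀ n : ℕ,
    Tendsto (fun t : ℝ => t⁻¹ * pseudoDist (p n) (e s + t • v.coord e) (e '' (e.source ∩ S)))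
      (𝓝[>] 0) (𝓝 0)}

/-- The second-order adjacent cone of `S ⊆ M` at `s ∈ S`: the vectors `w ∈ T_v (T M)`, where `v` is
in the adjacent cone of `S` at `s`, such that in some chart `e` around `s`, with
`w_{e_*} = (w₁, w₂)`, one has `w₁ = v_e` and
`t⁻² d_n (e s + t v_e + ½ t² w₂, e (U ∩ S)) → 0` as `t → 0⁺` for all `n`. -/
def secondAdjacentCone {k : ℕ∞} [BastianiManifold k F M] (p : ℕ → Seminorm ℝ F) (S : Set M)
    (s : M) : Set (DoubleTangentBdl F M) :=
  {w | w.base ∈ adjacentCone p S s ∧ ∃ e : atlas F M, s ∈ e.1.source ∧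
    (w.coord (tangentChart e)).1 = w.base.coord e.1 ∧ ∀ n : ℕ,
      Tendsto (fun t : ℝ => (t ^ 2)⁻¹ * pseudoDist (p n)
        (e.1 s + t • w.base.coord e.1 + (2⁻¹ * t ^ 2) • (w.coord (tangentChart e)).2)
        (e.1 '' (e.1.source ∩ S))) (𝓝[>] 0) (𝓝 0)}

/-- The admissible set `A_{V,S}`: the tangent vectors `v` with `τ v ∈ S` such that `V v` is in the
second-order adjacent cone of `S` at `τ v`. -/
def admissibleSet {k r : ℕ∞} [BastianiManifold k F M] (p : ℕ → Seminorm ℝ F) (V : Spray r F M)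
    (S : Set M) : Set (TangentBdl F M) :=
  {v | v.base ∈ S ∧ V.toFun v ∈ secondAdjacentCone p S v.base}

end Spray

end

end FrechetGeometry

/-! The implication from admissible velocities to points of `S` is contained in the definition: an
admissible vector has its foot in `S`, and the foot of `g'(t)` is `g t`.

For the other implication, fix `t` and read `g` in a chart `e` on a short interval `[t, b]`. The
curve `c = e ∘ g` has derivative `D`, the principal part of `g'`, and `g'' = V(g')` says that `D`
has at `t` the right-hand derivative `w₂`, the second component of `V(g'(t))`. Taylor's formula
gives `c(t+s) = c(t) + s D(t) + ½ s² w₂ + o(s²)` in every continuous seminorm. Since `c(t+s)` lies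
in `e(U ∩ S)`, it is a competitor in the infimum defining the distance, which is therefore `o(s²)`;
the first-order expansion gives the adjacent cone in the same way.

The analytic content is `tendsto_seminorm_taylor`. It rests on the mean value inequality
`seminorm_taylor_le`, obtained by separating a point from a closed convex seminorm ball and applying
the real mean value theorem to the separating functional. -/

namespace FrechetGeometry

open Set Filter Topology

/-! ### Distance to a set, bounded by a competitor in the set -/

section PseudoDist

variable {F : Type*} [AddCommGroup F] [Module ℝ F]

/-- No nonemptiness is needed: the real infimum of the empty set is `0` by convention. -/
theorem pseudoDist_nonneg (q : Seminorm ℝ F) (x : F) (A : Set F) : 0 ≤ pseudoDist q x A :=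
  Real.sInf_nonneg (by rintro _ ⟨y, _, rfl⟩; exact apply_nonneg _ _)

theorem pseudoDist_le (q : Seminorm ℝ F) (x : F) {A : Set F} {y : F} (hy : y ∈ A) :
    pseudoDist q x A ≤ q (x - y) :=
  csInf_le ⟨0, by rintro _ ⟨y, _, rfl⟩; exact apply_nonneg _ _⟩ ⟨y, hy, rfl⟩

/-- A point of `A` which approximates `x s` to the order of `a s` shows that the distance of `x s`
to `A` is of lower order. -/
theorem tendsto_pseudoDist {q : Seminorm ℝ F} {A : Set F} {a : ℝ → ℝ} {x y : ℝ → F}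
    (ha : ∀ᶠ s in 𝓝[>] (0 : ℝ), 0 ≤ a s) (hy : ∀ᶠ s in 𝓝[>] (0 : ℝ), y s ∈ A)
    (h : Tendsto (fun s => a s * q (y s - x s)) (𝓝[>] 0) (𝓝 0)) :
    Tendsto (fun s => a s * pseudoDist q (x s) A) (𝓝[>] 0) (𝓝 0) := by
  refine tendsto_of_tendsto_of_tendsto_of_le_of_le' tendsto_const_nhds h ?_ ?_
  · filter_upwards [ha] with s hs using mul_nonneg hs (pseudoDist_nonneg _ _ _)
  · filter_upwards [ha, hy] with s hs hys
    -- The distance is defined with `x - y`, while Taylor remainders come as `y - x`.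
    rw [map_sub_rev]
    exact mul_le_mul_of_nonneg_left (pseudoDist_le q _ hys) hs

end PseudoDist

/-! ### Taylor expansions of curves in locally convex spaces -/

section Curves

variable {F : Type*} [AddCommGroup F] [Module ℝ F] [TopologicalSpace F]

/-- Reduces vector-valued curves to real functions, to which the classical mean value theorem
applies. -/
theorem HasCurveDerivWithinAt.clm_comp {c : ℝ → F} {I : Set ℝ} {t : ℝ} {y : F}
    (hc : HasCurveDerivWithinAt c I t y) (l : StrongDual ℝ F) :
    HasDerivWithinAt (fun s => l (c s)) (l y) I t := by
  rw [hasDerivWithinAt_iff_tendsto_slope]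
  refine ((l.continuous.tendsto _).comp hc).congr fun s => ?_
  simp [slope_def_field, div_eq_inv_mul]

theorem HasCurveDerivWithinAt.mono {c : ℝ → F} {I J : Set ℝ} {t : ℝ} {y : F}
    (hc : HasCurveDerivWithinAt c I t y) (hJ : J ⊆ I) : HasCurveDerivWithinAt c J t y :=
  hc.mono_left (nhdsWithin_mono _ (sdiff_subset_sdiff_left hJ))

theorem HasCurveDerivWithinAt.fst {c : ℝ → F × F} {I : Set ℝ} {t : ℝ} {y : F × F}
    (hc : HasCurveDerivWithinAt c I t y) : HasCurveDerivWithinAt (fun s => (c s).1) I t y.1 :=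
  (continuous_fst.tendsto y).comp hc

theorem HasCurveDerivWithinAt.snd {c : ℝ → F × F} {I : Set ℝ} {t : ℝ} {y : F × F}
    (hc : HasCurveDerivWithinAt c I t y) : HasCurveDerivWithinAt (fun s => (c s).2) I t y.2 :=
  (continuous_snd.tendsto y).comp hc

variable [IsTopologicalAddGroup F]

/-- The slope minus `y` tends to `0` and `q` is continuous with `q 0 = 0`; for `s > 0` the factor
`s⁻¹` comes out of `q`. This is the first-order expansion, used for the adjacent cone and to control
`D` near `t` in the second-order one. -/
theorem HasCurveDerivWithinAt.tendsto_seminorm {q : Seminorm ℝ F} (hq : Continuous q) {c : ℝ → F}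
    {t b : ℝ} {y : F} (htb : t < b) (hc : HasCurveDerivWithinAt c (Icc t b) t y) :
    Tendsto (fun s : ℝ => s⁻¹ * q (c (t + s) - c t - s • y)) (𝓝[>] 0) (𝓝 0) := by
  have hshift : Tendsto (fun s : ℝ => t + s) (𝓝[>] 0) (𝓝[Icc t b \ {t}] t) := by
    refine tendsto_nhdsWithin_iff.2 ⟨?_, ?_⟩
    · have : Tendsto (fun s : ℝ => t + s) (𝓝 0) (𝓝 (t + 0)) := tendsto_const_nhds.add tendsto_id
      rw [add_zero] at this
      exact this.mono_left nhdsWithin_le_nhds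
    · filter_upwards [Ioo_mem_nhdsGT (sub_pos.2 htb)] with s hs
      exact ⟨⟨by linarith [hs.1], by linarith [hs.2]⟩, by simpa using hs.1.ne'⟩
  have h1 := ((hq.tendsto (y - y)).comp ((hc.comp hshift).sub_const y))
  rw [sub_self, map_zero] at h1
  refine h1.congr' ?_
  filter_upwards [self_mem_nhdsWithin] with s hs
  have hs : 0 < s := hs
  simp only [Function.comp_apply, add_sub_cancel_left]
  rw [show s⁻¹ • (c (t + s) - c t) - y = s⁻¹ • (c (t + s) - c t - s • y) by
      rw [smul_sub _ _ (s • y), smul_smul, inv_mul_cancel₀ hs.ne', one_smul],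
    map_smul_eq_mul, Real.norm_of_nonneg (inv_nonneg.2 hs.le)]

variable [ContinuousSMul ℝ F] [LocallyConvexSpace ℝ F]

/-- Second-order mean value inequality for a continuous seminorm. -/
theorem seminorm_taylor_le {q : Seminorm ℝ F} (hq : Continuous q) {c D : ℝ → F} {v w : F}
    {t b C : ℝ} (htb : t < b) (hc : ∀ s ∈ Icc t b, HasCurveDerivWithinAt c (Icc t b) s (D s))
    (hD : ∀ s ∈ Icc t b, q (D s - v - (s - t) • w) ≤ C) :
    q (c b - c t - (b - t) • v - (2⁻¹ * (b - t) ^ 2) • w) ≤ C * (b - t) := by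
  have hpos : 0 < b - t := sub_pos.2 htb
  set z := c b - c t - (b - t) • v - (2⁻¹ * (b - t) ^ 2) • w with hz
  -- The scaled remainder is an average of the values `D s - v - (s - t) • w`, which all lie in this
  -- closed convex ball. If it lay outside, Hahn–Banach would separate it strictly from the ball.
  have key : (b - t)⁻¹ • z ∈ {x | q x ≤ C} := by
    have hconv : Convex ℝ {x | q x ≤ C} := by
      simpa using q.convexOn.convex_le C
    by_contra hnot
    obtain ⟨l, a, hl, ha⟩ :=
      geometric_hahn_banach_closed_point hconv (isClosed_le hq continuous_const) hnot
    -- Subtracting the quadratic Taylor polynomial makes the derivative exactly `l` of a point of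
    -- the ball.
    have hder : ∀ s ∈ Icc t b, HasDerivWithinAt
        (fun s => l (c s) - (s - t) * l v - 2⁻¹ * (s - t) ^ 2 * l w)
        (l (D s - v - (s - t) • w)) (Icc t b) s := by
      intro s hs
      have h1 : HasDerivWithinAt (fun s : ℝ => s - t) 1 (Icc t b) s :=
        (hasDerivWithinAt_id s _).sub_const t
      refine ((((hc s hs).clm_comp l).sub (h1.mul_const (l v))).sub
        (((h1.pow 2).const_mul 2⁻¹).mul_const (l w))).congr_deriv ?_
      simp
    obtain ⟨s, hs, hs'⟩ := exists_hasDerivAt_eq_slope _ _ htb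
      (fun s hs => (hder s hs).continuousWithinAt)
      (fun s hs => (hder s (Ioo_subset_Icc_self hs)).hasDerivAt (Icc_mem_nhds hs.1 hs.2))
    have h2 := hl _ (hD s (Ioo_subset_Icc_self hs))
    have h3 : l ((b - t)⁻¹ • z) = l (D s - v - (s - t) • w) := by
      rw [hs', hz]
      simp only [map_smul, map_sub, smul_eq_mul]
      field_simp
      ring
    rw [h3] at ha
    exact lt_asymm h2 ha
  have h4 : q ((b - t)⁻¹ • z) ≤ C := key
  rw [map_smul_eq_mul, Real.norm_of_nonneg (inv_nonneg.2 hpos.le), inv_mul_le_iff₀ hpos] at h4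
  linarith

/-- Second-order Taylor formula, with Peano remainder, for a curve whose derivative `D` has the
one-sided derivative `w` at the left end point. -/
theorem tendsto_seminorm_taylor {q : Seminorm ℝ F} (hq : Continuous q) {c D : ℝ → F} {w : F}
    {t b : ℝ} (htb : t < b) (hc : ∀ s ∈ Icc t b, HasCurveDerivWithinAt c (Icc t b) s (D s))
    (hD : HasCurveDerivWithinAt D (Icc t b) t w) :
    Tendsto (fun s : ℝ => (s ^ 2)⁻¹ * q (c (t + s) - c t - s • D t - (2⁻¹ * s ^ 2) • w))
      (𝓝[>] 0) (𝓝 0) := by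
  rw [Metric.tendsto_nhds]
  intro ε hε
  -- Half of `ε` leaves room for a strict bound: `D` deviates by at most `ε / 2 * s` on `[t, t +
  -- s]`, so the remainder is at most `ε / 2 * s ^ 2`.
  have h1 := (Metric.tendsto_nhds.1 (hD.tendsto_seminorm hq htb)) (ε / 2) (half_pos hε)
  obtain ⟨δ, hδ, hδ'⟩ := mem_nhdsGT_iff_exists_Ioo_subset.1 h1
  have hδ0 : 0 < δ := hδ
  filter_upwards [Ioo_mem_nhdsGT (lt_min hδ0 (sub_pos.2 htb))] with s hs
  have hs0 : 0 < s := hs.1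
  have hsδ : s < δ := hs.2.trans_le (min_le_left _ _)
  have hsb : t + s ≤ b := by linarith [hs.2.trans_le (min_le_right δ (b - t))]
  have hle := seminorm_taylor_le (q := q) hq (c := c) (D := D) (v := D t) (w := w) (t := t)
    (b := t + s) (C := ε / 2 * s) (by linarith)
    (fun x hx => (hc x ⟨hx.1, hx.2.trans hsb⟩).mono (Icc_subset_Icc_right hsb)) (by
      intro x hx
      -- The estimate on `D` holds only to the right of `t`; at `t` itself the deviation vanishes.
      rcases hx.1.eq_or_lt with rfl | hlt
      · simpa using by positivity
      · have hx0 : 0 < x - t := sub_pos.2 hlt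
        have := hδ' (show x - t ∈ Ioo 0 δ from ⟨hx0, by linarith [hx.2]⟩)
        simp only [mem_ofPred_eq, dist_zero_right, add_sub_cancel] at this
        have h2 := (le_abs_self _).trans_lt this
        rw [inv_mul_lt_iff₀ hx0] at h2
        have h3 : (x - t) * (ε / 2) ≤ s * (ε / 2) := by
          gcongr
          linarith [hx.2]
        linarith)
  rw [add_sub_cancel_left] at hle
  rw [dist_zero_right, Real.norm_of_nonneg (by positivity), inv_mul_lt_iff₀ (by positivity)]
  nlinarith [mul_pos hε (pow_pos hs0 2)]

end Curves

/-! ### Geodesics read in charts -/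

section Geodesics

variable {F : Type*} [AddCommGroup F] [Module ℝ F] [TopologicalSpace F]
  [IsTopologicalAddGroup F] [ContinuousSMul ℝ F] [LocallyConvexSpace ℝ F] [T2Space F]
variable {M : Type*} [TopologicalSpace M] [ChartedSpace F M]

theorem tangentChart_mem_atlas {k : ℕ∞} [BastianiManifold k F M] (e : atlas F M) :
    tangentChart e ∈ atlas (F × F) (TangentBdl F M) :=
  mem_iUnion₂.2 ⟨tangentChartEquiv e, ⟨e, rfl⟩, rfl⟩

theorem tangentChart_apply {k : ℕ∞} [BastianiManifold k F M] (e : atlas F M)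
    (v : TangentBdl F M) : tangentChart e v = (e.1 v.base, v.coord e.1) := rfl

theorem mem_tangentChart_source {k : ℕ∞} [BastianiManifold k F M] {e : atlas F M}
    {v : TangentBdl F M} : v ∈ (tangentChart e).source ↔ v.base ∈ e.1.source := Iff.rfl

/-- A geodesic which stays in `S` has admissible velocity. -/
theorem IsGeodesicOn.canonicalLift_mem_admissibleSet {k r : ℕ∞} [BastianiManifold k F M]
    {p : ℕ → Seminorm ℝ F} (hp : ∀ n, Continuous (p n)) {V : Spray r F M} {S : Set M}
    {I : Set ℝ} (hI : I.OrdConnected) {g : ℝ → M} (hg : IsGeodesicOn V g I)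
    (hS : ∀ t ∈ I, g t ∈ S) {t t' : ℝ} (ht : t ∈ I) (ht' : t' ∈ I) (htt' : t < t') :
    canonicalLift F g I t ∈ admissibleSet p V S := by
  obtain ⟨hv, hw⟩ := hg t ht
  set e : atlas F M := ⟨chartAt F (g t), chart_mem_atlas F (g t)⟩ with he
  have hge : g t ∈ e.1.source := mem_chart_source F (g t)
  -- Staying below `t'` keeps `[t, b]` inside `I` by order-connectedness; staying within `δ / 2` of
  -- `t` keeps `g` in the chart domain by continuity.
  obtain ⟨b, htb, hbI, hbe⟩ : ∃ b, t < b ∧ Icc t b ⊆ I ∧ ∀ s ∈ Icc t b, g s ∈ e.1.source := by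
    obtain ⟨δ, hδ, hδ'⟩ := Metric.mem_nhdsWithin_iff.1 (hv.2.1 (e.1.open_source.mem_nhds hge))
    have hb : t < min t' (t + δ / 2) := lt_min htt' (by linarith)
    have hI' : Icc t (min t' (t + δ / 2)) ⊆ I :=
      (Icc_subset_Icc_right (min_le_left _ _)).trans (hI.out ht ht')
    refine ⟨_, hb, hI', fun s hs => hδ' ⟨?_, hI' hs⟩⟩
    have h1 := hs.2.trans (min_le_right _ _)
    rw [Metric.mem_ball, Real.dist_eq, abs_of_nonneg (sub_nonneg.2 hs.1)]
    linarith
  have htm : t ∈ Icc t b := left_mem_Icc.2 htb.le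
  have hc : ∀ s ∈ Icc t b, HasCurveDerivWithinAt (e.1 ∘ g) (Icc t b) s
      ((canonicalLift F g I s).coord e.1) := fun s hs =>
    ((hg s (hbI hs)).1.2.2 e.1 e.2 (hbe s hs)).mono hbI
  have hbase : ∀ s ∈ Icc t b, (canonicalLift F g I s).base = g s := fun s hs =>
    (hg s (hbI hs)).1.1
  -- The geodesic equation in the chart `T e`: the curve `(e ∘ g, D)` has at `t` the principal part
  -- of `V(g'(t))` as derivative.
  have hW := (hw.2.2 (tangentChart e) (tangentChart_mem_atlas e)
    (mem_tangentChart_source.2 (hv.1 ▸ hge))).mono hbI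
  have hVbase := V.base_toFun (canonicalLift F g I t)
  have hmem : ∀ᶠ s in 𝓝[>] (0 : ℝ), (e.1 ∘ g) (t + s) ∈ e.1 '' (e.1.source ∩ S) := by
    filter_upwards [Ioo_mem_nhdsGT (sub_pos.2 htb)] with s hs
    have hs' : t + s ∈ Icc t b := ⟨by linarith [hs.1], by linarith [hs.2]⟩
    exact ⟨_, ⟨hbe _ hs', hS _ (hbI hs')⟩, rfl⟩
  refine ⟨hv.1 ▸ hS t ht, ?_⟩
  simp only [secondAdjacentCone, mem_ofPred_eq, hVbase, hv.1]
  refine ⟨⟨hv.1, e.1, e.2, hge, fun n => ?_⟩, e, hge, ?_, fun n => ?_⟩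
  · refine tendsto_pseudoDist ?_ hmem ?_
    · filter_upwards [self_mem_nhdsWithin] with s hs using inv_nonneg.2 (le_of_lt hs)
    · refine ((hc t htm).tendsto_seminorm (hp n) htb).congr fun s => ?_
      rw [sub_sub]
      rfl
  -- Both vectors are derivatives of `e ∘ g` at `t`, since the first component of `T e ∘ g'` is `e ∘
  -- g`. Limits in a Hausdorff space are unique once the punctured filter is nontrivial, which uses
  -- `t < b`.
  · have : (𝓝[Icc t b \ {t}] t).NeBot := by
      rw [Icc_sdiff_left, nhdsWithin_Ioc_eq_nhdsGT htb]
      infer_instance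
    refine tendsto_nhds_unique (Tendsto.congr' ?_ hW.fst) (hc t htm)
    filter_upwards [self_mem_nhdsWithin] with s hs
    simp [tangentChart_apply, hbase s hs.1, hbase t htm]
  · refine tendsto_pseudoDist (Eventually.of_forall fun s => inv_nonneg.2 (sq_nonneg s)) hmem ?_
    refine (tendsto_seminorm_taylor (hp n) htb hc hW.snd).congr fun s => ?_
    rw [sub_sub, sub_sub, add_assoc]
    rfl

end Geodesics

end FrechetGeometry

open FrechetGeometry in
theorem theorem2p1 {F M : Type*} [AddCommGroup F] [Module ℝ F] [UniformSpace F]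
    [IsUniformAddGroup F] [ContinuousSMul ℝ F] [LocallyConvexSpace ℝ F] [CompleteSpace F]
    [T2Space F] (p : ℕ → Seminorm ℝ F) (hp : WithSeminorms p)
    [TopologicalSpace M] [T2Space M] [ChartedSpace F M]
    {k r : ℕ∞} (hk : 4 ≤ k) [BastianiManifold k F M] (hr : 1 ≤ r) (hrk : r + 2 ≤ k)
    (V : Spray r F M) (S : Set M) (hS : IsClosed S) (hne : S.Nonempty)
    (I : Set ℝ) (hI : I.OrdConnected) (hI_right : ∀ t ∈ I, ∃ t' ∈ I, t < t')
    (g : ℝ → M) (hg : IsGeodesicOn V g I) :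
    (∀ t ∈ I, g t ∈ S) ↔ ∀ t ∈ I, canonicalLift F g I t ∈ admissibleSet p V S := by
  refine ⟨fun hgS t ht => ?_, fun h t ht => (hg t ht).1.1 ▸ (h t ht).1⟩
  -- The cones look at `s → 0⁺`, so every time of `I` needs a later one in `I`.
  obtain ⟨t', ht', htt'⟩ := hI_right t ht
  exact hg.canonicalLift_mem_admissibleSet hp.continuous_seminorm hI hgS ht ht' htt'
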